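/- Let $K$ be a field and let $C^n_\omega$ be an edge-weighted cycle on the vertex set $[n]=\{1,\dots,n\}$, that is, a connected simple graph on $[n]$ in which every vertex has degree $2$, together with a weight function $\omega$ assigning a positive integer to each edge. Let $$I=I(C^n_\omega)=\bigl(x_i^{\omega(e)}x_j^{\omega(e)} \;:\; e=\{i,j\}\in E(C^n_\omega)\bigr)\subseteq K[x_1,\dots,x_n]$$ be its edge ideal. For an ideal $J$ of a commutative ring $R$, the integral closure $\overline{J}$ is the set of all $f\in R$ that satisfy an equation $f^k+c_1f^{k-1}+\dots+c_{k-1}f+c_k=0$ with $k\ge 1$ and $c_i\in J^i$ for $1\le i\le k$; $J$ is integrally closed if $J=\overline{J}$, and normal if $J^k$ is integrally closed for every $k\ge 1$. If $I$ is integrally closed, then $I$ is normal. -/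

import Mathlib

/-- An element `f` of `R` is integral over the ideal `I` if it satisfies an equation
`f ^ k + c₁ f ^ (k - 1) + ⋯ + c_k = 0` with `k ≥ 1` and `c_i ∈ I ^ i`. -/
def Ideal.IsIntegralElem {R : Type*} [CommRing R] (I : Ideal R) (f : R) : Prop :=
  ∃ k : ℕ, 1 ≤ k ∧ ∃ c : ℕ → R, (∀ i ∈ Finset.Icc 1 k, c i ∈ I ^ i) ∧
    f ^ k + ∑ i ∈ Finset.Icc 1 k, c i * f ^ (k - i) = 0

/-- The integral closure of an ideal: the set of all elements that are integral over it. -/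
def Ideal.integralClosureSet {R : Type*} [CommRing R] (I : Ideal R) : Set R :=
  {f | I.IsIntegralElem f}

/-- An ideal is integrally closed if it equals its integral closure. -/
def Ideal.IsIntegrallyClosedIdeal {R : Type*} [CommRing R] (I : Ideal R) : Prop :=
  (I : Set R) = I.integralClosureSet

/-- An ideal is normal if all its powers `I ^ k`, `k ≥ 1`, are integrally closed. -/
def Ideal.IsNormalIdeal {R : Type*} [CommRing R] (I : Ideal R) : Prop :=
  ∀ k : ℕ, 1 ≤ k → (I ^ k).IsIntegrallyClosedIdeal

/-- A simple graph on `V` with a positive integer weight on each edge. -/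
structure EdgeWeightedGraph (V : Type*) where
  graph : SimpleGraph V
  weight : graph.edgeSet → ℕ+

namespace EdgeWeightedGraph

/-- A weighted graph is a cycle if it is connected and every vertex has degree two. -/
def IsCycle {V : Type*} (G : EdgeWeightedGraph V) : Prop :=
  G.graph.Connected ∧ ∀ v : V, (G.graph.neighborSet v).ncard = 2

/-- The edge ideal, generated by the monomials `x_i ^ ω(e) * x_j ^ ω(e)` for edges `e = {i, j}`. -/
noncomputable def edgeIdeal {V : Type*} (G : EdgeWeightedGraph V) (K : Type*) [Field K] :
    Ideal (MvPolynomial V K) :=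
  Ideal.span {m | ∃ (i j : V) (h : G.graph.Adj i j),
    m = MvPolynomial.X i ^ (G.weight ⟨s(i, j), h⟩ : ℕ) *
      MvPolynomial.X j ^ (G.weight ⟨s(i, j), h⟩ : ℕ)}

end EdgeWeightedGraph

/-! If `f` is integral over `I ^ k`, linear programming duality shows that each exponent `d` of `f`
admits a fractional packing: nonnegative reals `y e` of sum `k` with `∑ y e * edgeExponent e ≤ d`
(`exists_fractional_of_isIntegralElem_pow`). It remains to replace `y` by an integral packing of
size at least `k`. Integral closedness of `I` forces any two distinct edges of weight at least 2 to
be joined by an edge of weight one (`exists_trivial_edge`). Moving mass onto such joining edges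
leaves at most one nontrivial edge `e₀` in use (`exists_trivial_off`). Deleting `e₀` turns the cycle
into a path, where the edges at a vertex are consecutive. The remaining constraints thus form a 0/1
interval system, which rounds by partial sums (`exists_nat_rounding`). Rounding up on the path and
down at `e₀` keeps the total at least `k` (`IsFractionalPacking.exists_nat`). -/

theorem Ideal.isIntegralElem_of_pow_mem {R : Type*} [CommRing R] {I : Ideal R} {f : R} {k : ℕ}
    (hk : 1 ≤ k) (h : f ^ k ∈ I ^ k) : I.IsIntegralElem f := by
  refine ⟨k, hk, fun i => if i = k then -f ^ k else 0, fun i _ => ?_, ?_⟩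
  · dsimp only
    split_ifs with hi
    · subst hi
      exact neg_mem h
    · exact zero_mem _
  · simp [hk]

/-! ### Weighted orders as valuations -/

section WeightedOrder

open MvPowerSeries

variable {σ R : Type*} [CommRing R] [IsDomain R]

/-- The ideal of all polynomials of weighted order at least `m`. -/
def MvPolynomial.weightIdeal (R : Type*) [CommRing R] [IsDomain R] (w : σ → ℕ) (m : ℕ) :
    Ideal (MvPolynomial σ R) where
  carrier := {f | (m : ℕ∞) ≤ (f : MvPowerSeries σ R).weightedOrder w}
  zero_mem' := by simp
  add_mem' {f g} hf hg := by
    simp only [Set.mem_ofPred_eq, MvPolynomial.coe_add] at *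
    exact (le_min hf hg).trans (min_weightedOrder_le_add w)
  smul_mem' c f hf := by
    simp only [Set.mem_ofPred_eq, smul_eq_mul, MvPolynomial.coe_mul, weightedOrder_mul] at *
    exact hf.trans le_add_self

namespace MvPolynomial

theorem mem_weightIdeal {w : σ → ℕ} {m : ℕ} {f : MvPolynomial σ R} :
    f ∈ weightIdeal R w m ↔ (m : ℕ∞) ≤ (f : MvPowerSeries σ R).weightedOrder w :=
  Iff.rfl

theorem le_weight_of_mem_weightIdeal {w : σ → ℕ} {m : ℕ} {f : MvPolynomial σ R}
    (hf : f ∈ weightIdeal R w m) {d : σ →₀ ℕ} (hd : d ∈ f.support) : m ≤ Finsupp.weight w d := by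
  rw [mem_weightIdeal] at hf
  have := hf.trans (weightedOrder_le w (f := (f : MvPowerSeries σ R)) (d := d)
    (by simpa [coeff_coe] using hd))
  exact_mod_cast this

theorem monomial_mem_weightIdeal {w : σ → ℕ} {m : ℕ} {d : σ →₀ ℕ} {r : R}
    (hd : m ≤ Finsupp.weight w d) : monomial d r ∈ weightIdeal R w m := by
  classical
  rw [mem_weightIdeal]
  refine nat_le_weightedOrder w fun e he => ?_
  rw [coeff_coe, coeff_monomial, if_neg]
  rintro rfl
  omega

theorem mul_mem_weightIdeal {w : σ → ℕ} {m n : ℕ} {f g : MvPolynomial σ R}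
    (hf : f ∈ weightIdeal R w m) (hg : g ∈ weightIdeal R w n) :
    f * g ∈ weightIdeal R w (m + n) := by
  rw [mem_weightIdeal] at *
  rw [coe_mul, weightedOrder_mul, Nat.cast_add]
  exact add_le_add hf hg

theorem weightIdeal_anti {w : σ → ℕ} {m n : ℕ} (h : m ≤ n) :
    weightIdeal R w n ≤ weightIdeal R w m := by
  intro f hf
  rw [mem_weightIdeal] at *
  exact le_trans (by exact_mod_cast h) hf

theorem pow_le_weightIdeal {w : σ → ℕ} {m : ℕ} {J : Ideal (MvPolynomial σ R)}
    (hJ : J ≤ weightIdeal R w m) (i : ℕ) : J ^ i ≤ weightIdeal R w (i * m) := by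
  induction i with
  | zero => intro f _; simp [mem_weightIdeal]
  | succ i ih =>
    rw [pow_succ, Ideal.mul_le]
    intro f hf g hg
    rw [Nat.succ_mul]
    exact mul_mem_weightIdeal (ih hf) (hJ hg)

theorem pow_mem_weightIdeal {w : σ → ℕ} {m : ℕ} {f : MvPolynomial σ R}
    (hf : f ∈ weightIdeal R w m) (i : ℕ) : f ^ i ∈ weightIdeal R w (i * m) :=
  pow_le_weightIdeal (le_refl (weightIdeal R w m)) i (Ideal.pow_mem_pow hf i)

/-- The ideals `weightIdeal R w m` are integrally closed. -/
theorem mem_weightIdeal_of_isIntegralElem {w : σ → ℕ} {m : ℕ} {J : Ideal (MvPolynomial σ R)}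
    (hJ : J ≤ weightIdeal R w m) {f : MvPolynomial σ R} (hf : J.IsIntegralElem f) :
    f ∈ weightIdeal R w m := by
  obtain ⟨k, hk, c, hc, h⟩ := hf
  by_contra hfm
  have hlt : (f : MvPowerSeries σ R).weightedOrder w < m := not_le.mp hfm
  obtain ⟨d, hd⟩ := ENat.ne_top_iff_exists.mp (ne_top_of_lt hlt)
  have hdm : d < m := by rw [← hd] at hlt; exact_mod_cast hlt
  have hfd : f ∈ weightIdeal R w d := by rw [mem_weightIdeal, hd]
  -- Each `c i * f ^ (k - i)` has order at least `i * m + (k - i) * d`, which exceeds `k * d`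
  -- because `i ≥ 1` and `d < m`; but `f ^ k` has order exactly `k * d`.
  have hmem : f ^ k ∈ weightIdeal R w (k * d + 1) := by
    rw [eq_neg_of_add_eq_zero_left h]
    refine neg_mem (sum_mem fun i hi => ?_)
    refine weightIdeal_anti ?_
      (mul_mem_weightIdeal (pow_le_weightIdeal hJ i (hc i hi)) (pow_mem_weightIdeal hfd (k - i)))
    obtain ⟨h1, h2⟩ := Finset.mem_Icc.mp hi
    obtain ⟨j, rfl⟩ := Nat.exists_eq_add_of_le h2
    rw [Nat.add_sub_cancel_left]
    nlinarith
  rw [mem_weightIdeal] at hmem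
  have hord : ((f ^ k : MvPolynomial σ R) : MvPowerSeries σ R).weightedOrder w = (k * d : ℕ) := by
    have key : ∀ j : ℕ, ((f ^ j : MvPolynomial σ R) : MvPowerSeries σ R).weightedOrder w
        = (j * d : ℕ) := by
      intro j
      induction j with
      | zero => simp
      | succ j ih =>
        rw [pow_succ, coe_mul, weightedOrder_mul, ih, ← hd, Nat.succ_mul, Nat.cast_add]
    exact key k
  rw [hord] at hmem
  have : k * d + 1 ≤ k * d := by exact_mod_cast hmem
  omega

end MvPolynomial

end WeightedOrder

/-! ### Linear programming duality -/

section Alternative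

open scoped Pointwise

variable {ι V : Type*} [Fintype ι] [Fintype V]

/-- A form of linear programming duality: either some convex combination of the vectors `A i` lies
below `β`, or a nonnegative functional strictly separates `β` from all the `A i`. -/
theorem exists_stdSimplex_le_or_exists_separating [Nonempty ι] (A : ι → V → ℝ) (β : V → ℝ) :
    (∃ y ∈ stdSimplex ℝ ι, ∀ v, ∑ i, y i * A i v ≤ β v) ∨
      ∃ l : V → ℝ, (∀ v, 0 ≤ l v) ∧ ∀ i, ∑ v, l v * β v < ∑ v, l v * A i v := by
  classical
  let φ : (ι → ℝ) →ₗ[ℝ] (V → ℝ) :=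
    { toFun := fun y v => ∑ i, y i * A i v
      map_add' := by intro x y; ext v; simp [add_mul, Finset.sum_add_distrib]
      map_smul' := by intro c x; ext v; simp [mul_assoc, Finset.mul_sum] }
  have hφ : Continuous φ := φ.continuous_of_finiteDimensional
  have hcl : IsClosed (φ '' stdSimplex ℝ ι + Set.Ici (0 : V → ℝ)) :=
    isClosed_Ici.add_left_of_isCompact ((isCompact_stdSimplex ℝ ι).image hφ)
  have hcv : Convex ℝ (φ '' stdSimplex ℝ ι + Set.Ici (0 : V → ℝ)) :=
    ((convex_stdSimplex ℝ ι).linear_image φ).add (convex_Ici 0)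
  by_cases hβ : β ∈ φ '' stdSimplex ℝ ι + Set.Ici (0 : V → ℝ)
  · left
    obtain ⟨_, ⟨y, hy, rfl⟩, u, hu, rfl⟩ := hβ
    exact ⟨y, hy, fun v => le_add_of_nonneg_right (hu v)⟩
  · right
    obtain ⟨F, u, hF, hFu⟩ := geometric_hahn_banach_point_closed hcv hcl hβ
    have hFsum : ∀ x : V → ℝ, F x = ∑ v, F (Pi.single v 1) * x v := by
      intro x
      conv_lhs => rw [← Finset.univ_sum_single x]
      rw [map_sum]
      refine Finset.sum_congr rfl fun v _ => ?_
      have : (Pi.single v (x v) : V → ℝ) = x v • Pi.single v 1 := by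
        rw [← Pi.single_smul]; simp
      rw [this, map_smul, smul_eq_mul, mul_comm]
    have hA : ∀ i, ∀ x : V → ℝ, 0 ≤ x → u < F (A i) + F x := by
      intro i x hx
      rw [← map_add]
      refine hFu _ (Set.add_mem_add ⟨Pi.single i 1, single_mem_stdSimplex ℝ i, ?_⟩ hx)
      ext v
      simp [φ, Pi.single_apply]
    refine ⟨fun v => F (Pi.single v 1), fun v => ?_, fun i => ?_⟩
    -- With a negative coefficient at `v`, a large multiple of the basis vector at `v` would push
    -- `F` below `u`.
    · by_contra hneg
      push Not at hneg
      obtain ⟨i⟩ := ‹Nonempty ι›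
      set b := F (Pi.single v 1) with hb
      obtain ⟨N, hN⟩ := exists_nat_gt ((F (A i) - u) / (-b))
      rw [div_lt_iff₀ (by linarith)] at hN
      have h0 : (0 : V → ℝ) ≤ (N : ℝ) • Pi.single v 1 :=
        smul_nonneg (Nat.cast_nonneg N) (Pi.single_nonneg.mpr zero_le_one)
      have := hA i _ h0
      rw [map_smul, smul_eq_mul, ← hb] at this
      linarith
    · rw [← hFsum, ← hFsum]
      have := hA i 0 le_rfl
      rw [map_zero, add_zero] at this
      exact hF.trans this

/-- For integral data the separating functional can be chosen integral. -/
theorem exists_stdSimplex_le_or_exists_nat_separating [Nonempty ι] (A : ι → V → ℕ) (β : V → ℕ) :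
    (∃ y ∈ stdSimplex ℝ ι, ∀ v, ∑ i, y i * A i v ≤ β v) ∨
      ∃ l : V → ℕ, ∀ i, ∑ v, l v * β v < ∑ v, l v * A i v := by
  refine (exists_stdSimplex_le_or_exists_separating (fun i v => (A i v : ℝ))
    (fun v => (β v : ℝ))).imp id ?_
  rintro ⟨l, hl0, hl⟩
  -- After scaling by a large `N`, the gap exceeds `∑ β v`, which bounds the error made by taking
  -- ceilings.
  have hev : ∀ i, ∀ᶠ N : ℕ in Filter.atTop,
      (∑ v, (β v : ℝ)) < N * (∑ v, l v * A i v - ∑ v, l v * β v) := by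
    intro i
    exact (tendsto_natCast_atTop_atTop.atTop_mul_const (sub_pos.mpr (hl i))).eventually_gt_atTop _
  obtain ⟨N, hN⟩ := (Filter.eventually_all.mpr hev).exists
  refine ⟨fun v => ⌈N * l v⌉₊, fun i => ?_⟩
  have h1 : ∑ v, (⌈N * l v⌉₊ : ℝ) * β v ≤ N * ∑ v, l v * β v + ∑ v, (β v : ℝ) := by
    rw [Finset.mul_sum, ← Finset.sum_add_distrib]
    refine Finset.sum_le_sum fun v _ => ?_
    have := (Nat.ceil_lt_add_one (mul_nonneg (Nat.cast_nonneg N) (hl0 v))).le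
    calc (⌈N * l v⌉₊ : ℝ) * β v ≤ (N * l v + 1) * β v := by gcongr
      _ = _ := by ring
  have h2 : N * ∑ v, l v * A i v ≤ ∑ v, (⌈N * l v⌉₊ : ℝ) * A i v := by
    rw [Finset.mul_sum]
    refine Finset.sum_le_sum fun v _ => ?_
    rw [← mul_assoc]
    gcongr
    exact Nat.le_ceil _
  have h3 := hN i
  rw [mul_sub] at h3
  have : ∑ v, (⌈N * l v⌉₊ : ℝ) * β v < ∑ v, (⌈N * l v⌉₊ : ℝ) * A i v := by linarith
  exact_mod_cast this

end Alternative

/-! ### Powers of monomial ideals -/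

section MonomialIdeal

variable {ι V K : Type*} [Fintype ι] [Field K]

open MvPolynomial

/-- Otherwise duality gives a weight `l` for which `d` weighs less than `k` times the lightest
generator, contradicting integral closedness of `weightIdeal`. -/
theorem exists_fractional_of_isIntegralElem_pow [Fintype V] [Nonempty ι] (a : ι → V →₀ ℕ) (k : ℕ)
    {f : MvPolynomial V K}
    (hf : (Ideal.span (Set.range fun i => monomial (a i) (1 : K)) ^ k).IsIntegralElem f)
    {d : V →₀ ℕ} (hd : d ∈ f.support) :
    ∃ y : ι → ℝ, (∀ i, 0 ≤ y i) ∧ ∑ i, y i = k ∧ ∀ v, ∑ i, y i * a i v ≤ d v := by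
  obtain ⟨y, ⟨hy0, hy1⟩, hy⟩ | ⟨l, hl⟩ :=
    exists_stdSimplex_le_or_exists_nat_separating (fun i v => k * a i v) (fun v => d v)
  · refine ⟨fun i => k * y i, fun i => mul_nonneg (Nat.cast_nonneg k) (hy0 i), ?_, fun v => ?_⟩
    · rw [← Finset.mul_sum, hy1, mul_one]
    · refine le_trans (le_of_eq ?_) (hy v)
      refine Finset.sum_congr rfl fun i _ => ?_
      push_cast
      ring
  · exfalso
    have hweight : ∀ e : V →₀ ℕ, Finsupp.weight l e = ∑ v, l v * e v := by
      intro e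
      rw [Finsupp.weight_apply, Finsupp.sum_fintype _ _ (by simp)]
      simp [mul_comm]
    obtain ⟨i₀, -, hi₀⟩ := Finset.exists_min_image Finset.univ
      (fun i => Finsupp.weight l (a i)) Finset.univ_nonempty
    have hspan : Ideal.span (Set.range fun i => monomial (a i) (1 : K)) ≤
        weightIdeal K l (Finsupp.weight l (a i₀)) := by
      rw [Ideal.span_le]
      rintro _ ⟨i, rfl⟩
      exact monomial_mem_weightIdeal (hi₀ i (Finset.mem_univ i))
    have h1 := le_weight_of_mem_weightIdeal
      (mem_weightIdeal_of_isIntegralElem (pow_le_weightIdeal hspan k) hf) hd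
    have h2 := hl i₀
    rw [hweight, hweight, Finset.mul_sum] at h1
    refine absurd h2 (not_lt.mpr (le_trans (le_of_eq ?_) h1))
    exact Finset.sum_congr rfl fun v _ => by ring

theorem monomial_mem_span_pow (a : ι → V →₀ ℕ) {k : ℕ} (z : ι → ℕ) (hz : k ≤ ∑ i, z i)
    {d : V →₀ ℕ} (hd : ∀ v, ∑ i, z i * a i v ≤ d v) (r : K) :
    monomial d r ∈ Ideal.span (Set.range fun i => monomial (a i) (1 : K)) ^ k := by
  set I := Ideal.span (Set.range fun i => monomial (a i) (1 : K))
  have hprod : ∏ i, monomial (a i) (1 : K) ^ z i ∈ I ^ k := by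
    refine Ideal.pow_le_pow_right hz ?_
    rw [← Finset.prod_pow_eq_pow_sum]
    exact Ideal.prod_mem_prod fun i _ =>
      Ideal.pow_mem_pow (Ideal.subset_span (Set.mem_range_self i)) _
  have hle : ∑ i, z i • a i ≤ d := by
    intro v
    simpa using hd v
  have heq : ∏ i, monomial (a i) (1 : K) ^ z i = monomial (∑ i, z i • a i) 1 := by
    simp only [monomial_pow, one_pow]
    rw [monomial_sum_one]
  rw [← tsub_add_cancel_of_le hle, ← mul_one r, ← monomial_mul, ← heq]
  exact Ideal.mul_mem_left _ _ hprod

end MonomialIdeal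

/-! ### Rounding interval systems -/

section Rounding

/-- Differences of the rounded-up partial sums telescope over intervals, and `⌈S s + c⌉ = ⌈S s⌉ + c`
for integral `c`. -/
theorem exists_nat_rounding (m : ℕ) (y : ℕ → ℝ) (hy : ∀ i, 0 ≤ y i) :
    ∃ z : ℕ → ℕ, (∀ i, y i = 0 → z i = 0) ∧
      (∑ i ∈ Finset.range m, y i ≤ ∑ i ∈ Finset.range m, (z i : ℝ)) ∧
      ∀ s t c : ℕ, ∑ i ∈ Finset.Ico s t, y i ≤ c → ∑ i ∈ Finset.Ico s t, z i ≤ c := by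
  set S : ℕ → ℝ := fun j => ∑ i ∈ Finset.range j, y i with hS
  have hmono : Monotone fun j => ⌈S j⌉₊ :=
    monotone_nat_of_le_succ fun j => Nat.ceil_mono (by
      simp only [hS, Finset.sum_range_succ]
      linarith [hy j])
  refine ⟨fun i => ⌈S (i + 1)⌉₊ - ⌈S i⌉₊, fun i hi => ?_, ?_, fun s t c h => ?_⟩
  · simp [hS, Finset.sum_range_succ, hi]
  · rw [← Nat.cast_sum, Finset.sum_range_tsub hmono]
    refine (Nat.le_ceil _).trans (le_of_eq ?_)
    simp [hS]
  · rcases le_total s t with hst | hst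
    · have htel : ∑ i ∈ Finset.Ico s t, (⌈S (i + 1)⌉₊ - ⌈S i⌉₊) = ⌈S t⌉₊ - ⌈S s⌉₊ := by
        induction t, hst using Nat.le_induction with
        | base => simp
        | succ t hst ih =>
          rw [Finset.sum_Ico_succ_top hst, ih]
          · have h1 := hmono hst
            have h2 := hmono (Nat.le_succ t)
            simp only at h1 h2
            simp only [Nat.succ_eq_add_one] at h2
            omega
          · rw [Finset.sum_Ico_succ_top hst] at h
            linarith [hy t]
      rw [htel, tsub_le_iff_left, ← Nat.ceil_add_natCast (Finset.sum_nonneg fun i _ => hy i)]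
      refine Nat.ceil_mono ?_
      have := Finset.sum_range_add_sum_Ico y hst
      simp only [hS]
      linarith
    · simp [Finset.Ico_eq_empty_of_le hst]

theorem sum_eq_sum_range_of_nodup {ι M : Type*} [Fintype ι] [AddCommMonoid M] {L : List ι}
    (hL : L.Nodup) (F : ι → M) (hF : ∀ i, i ∉ L → F i = 0) :
    ∑ i, F i = ∑ j ∈ Finset.range L.length, if h : j < L.length then F L[j] else 0 := by
  classical
  have h1 : ∑ i, F i = ∑ i ∈ L.toFinset, F i :=
    (Finset.sum_subset (Finset.subset_univ _) fun i _ hi => hF i (by simpa using hi)).symm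
  rw [h1, Finset.sum_range, List.sum_toFinset _ hL]
  simp

theorem exists_rounding_of_list {ι : Type*} [Fintype ι] {L : List ι} (hL : L.Nodup) (y : ι → ℝ)
    (hy : ∀ i, 0 ≤ y i) (hyL : ∀ i, i ∉ L → y i = 0) :
    ∃ z : ι → ℕ, (∀ i, y i = 0 → z i = 0) ∧ (∑ i, y i ≤ ∑ i, (z i : ℝ)) ∧
      ∀ P : ι → Prop, ∀ [DecidablePred P],
        (∃ s t, ∀ (j : ℕ) (h : j < L.length), P L[j] ↔ s ≤ j ∧ j < t) →
        ∀ c : ℕ, (∑ i, if P i then y i else 0) ≤ c → (∑ i, if P i then z i else 0) ≤ c := by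
  classical
  obtain ⟨z, hz0, hzm, hz⟩ := exists_nat_rounding L.length
    (fun j => if h : j < L.length then y L[j] else 0)
    (fun j => by split_ifs; exacts [hy _, le_rfl])
  refine ⟨fun i => if i ∈ L then z (L.idxOf i) else 0, fun i hi => ?_, ?_, ?_⟩
  · dsimp only
    split_ifs with h
    · exact hz0 _ (by simp [List.idxOf_lt_length_iff.mpr h, hi])
    · rfl
  · rw [sum_eq_sum_range_of_nodup hL y hyL,
      sum_eq_sum_range_of_nodup hL _ (fun i hi => by simp [hi])]
    refine hzm.trans (le_of_eq (Finset.sum_congr rfl fun j hj => ?_))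
    have hj' := Finset.mem_range.mp hj
    simp [hj', hL.idxOf_getElem]
  · rintro P _ ⟨s, t, hst⟩ c hc
    rw [sum_eq_sum_range_of_nodup hL _ (fun i hi => by simp [hyL i hi])] at hc
    rw [sum_eq_sum_range_of_nodup hL _ (fun i hi => by simp [hi])]
    have hIco : (Finset.range L.length).filter (fun j => s ≤ j ∧ j < t) =
        Finset.Ico s (min t L.length) := by
      ext j
      simp only [Finset.mem_filter, Finset.mem_range, Finset.mem_Ico]
      omega
    have hc' : ∑ j ∈ Finset.Ico s (min t L.length),
        (if h : j < L.length then y L[j] else 0) ≤ c := by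
      refine le_trans (le_of_eq ?_) hc
      rw [← hIco, Finset.sum_filter]
      refine Finset.sum_congr rfl fun j hj => ?_
      have hj' := Finset.mem_range.mp hj
      simp [hj', hst j hj']
    refine le_trans (le_of_eq ?_) (hz _ _ c hc')
    rw [← hIco, Finset.sum_filter]
    refine Finset.sum_congr rfl fun j hj => ?_
    have hj' := Finset.mem_range.mp hj
    simp [hj', hst j hj', hL.idxOf_getElem]

end Rounding

/-! ### Cutting a cycle open into a path -/

section CycleGraph

namespace SimpleGraph

variable {V : Type*} {G : SimpleGraph V}

theorem Walk.IsPath.exists_mem_edges_iff {u w : V} {p : G.Walk u w} (hp : p.IsPath) (x : V) :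
    ∃ s t : ℕ, ∀ (i : ℕ) (h : i < p.edges.length), x ∈ p.edges[i] ↔ s ≤ i ∧ i < t := by
  have hedge : ∀ (i : ℕ) (h : i < p.edges.length),
      x ∈ p.edges[i] ↔ p.getVert i = x ∨ p.getVert (i + 1) = x := by
    intro i h
    rw [p.getElem_edges_eq_edge_getElem_darts h]
    have hd : i < p.darts.length := by simpa using h
    rw [p.darts_getElem_eq_getVert i hd]
    simp [eq_comm]
  by_cases hx : x ∈ p.support
  · obtain ⟨j, hj, hjl⟩ := Walk.mem_support_iff_exists_getVert.mp hx
    -- A path visits `x` only at position `j`, so only edges `j - 1` and `j` can contain it; for `j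
    -- = 0` truncation leaves edge `0` alone.
    refine ⟨j - 1, j + 1, fun i h => ?_⟩
    have hi : i < p.length := by simpa using h
    rw [hedge i h, ← hj, hp.getVert_injOn.eq_iff (by simp; omega) (by simpa using hjl),
      hp.getVert_injOn.eq_iff (by simp; omega) (by simpa using hjl)]
    omega
  · refine ⟨0, 0, fun i h => ?_⟩
    rw [hedge i h]
    simp only [not_lt_zero, and_false, iff_false]
    rintro (h | h) <;> exact hx (h ▸ p.getVert_mem_support _)

/-- In a finite cycle graph, the edges other than `e` can be listed in the order in which they
appear on a path, so that the edges at any vertex are consecutive. -/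
theorem Connected.exists_list_edges [Finite V] (hG : G.Connected)
    (hdeg : ∀ v, (G.neighborSet v).ncard = 2) {e : Sym2 V} (he : e ∈ G.edgeSet) :
    ∃ L : List (Sym2 V), L.Nodup ∧ (∀ f ∈ L, f ∈ G.edgeSet) ∧ e ∉ L ∧
      (∀ f ∈ G.edgeSet, f ≠ e → f ∈ L) ∧
      ∀ x, ∃ s t : ℕ, ∀ (i : ℕ) (h : i < L.length), x ∈ L[i] ↔ s ≤ i ∧ i < t := by
  classical
  have := Fintype.ofFinite V
  have hcyc : G.IsCycles := fun v _ => hdeg v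
  induction e with
  | _ a b =>
    have hab : G.Adj a b := he
    obtain ⟨q, hq⟩ := (hcyc.reachable_deleteEdges hab.symm).exists_isPath
    let p := q.mapLe (G.deleteEdges_le {s(b, a)})
    have hp : p.IsPath := hq.mapLe _
    have hnot : s(a, b) ∉ p.edges := by
      intro h
      rw [Walk.edges_mapLe_eq_edges] at h
      have := q.edges_subset_edgeSet h
      rw [edgeSet_deleteEdges, Sym2.eq_swap] at this
      exact this.2 rfl
    have hcycle : (Walk.cons hab p).IsCycle := (Walk.cons_isCycle_iff _ _).mpr ⟨hp, hnot⟩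
    have hadj : ∀ x ∈ (Walk.cons hab p).toSubgraph.verts, ∀ y,
        (Walk.cons hab p).toSubgraph.Adj x y ↔ G.Adj x y :=
      fun x hx => hcycle.adj_toSubgraph_iff_of_isCycles hcyc hx
    -- The cycle already contains every neighbour of its vertices, so by connectedness it is
    -- spanning.
    have hverts : ∀ x, x ∈ (Walk.cons hab p).toSubgraph.verts := by
      intro x
      obtain ⟨r⟩ := hG.preconnected a x
      have key : ∀ {u v : V} (r : G.Walk u v), u ∈ (Walk.cons hab p).toSubgraph.verts →
          v ∈ (Walk.cons hab p).toSubgraph.verts := by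
        intro u v r
        induction r with
        | nil => exact id
        | cons h _ ih => exact fun hu => ih (((hadj _ hu _).mpr h).snd_mem)
      exact key r (by simp)
    refine ⟨p.edges, hp.isTrail.edges_nodup, fun f hf => p.edges_subset_edgeSet hf, hnot, ?_,
      hp.exists_mem_edges_iff⟩
    intro f hf hne
    induction f with
    | _ x y =>
      have := Walk.adj_toSubgraph_iff_mem_edges.mp ((hadj x (hverts x) y).mpr hf)
      rw [Walk.edges_cons, List.mem_cons] at this
      exact this.resolve_left hne

end SimpleGraph

end CycleGraph

namespace EdgeWeightedGraph

open MvPolynomial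

variable {V : Type*}

/-! ### Consequences of integral closedness for the weights -/

section EdgeExponent

variable [Finite V] (C : EdgeWeightedGraph V)

open Classical in
/-- The exponent vector of the generator of the edge ideal that belongs to the edge `e`. -/
noncomputable def edgeExponent (e : C.graph.edgeSet) : V →₀ ℕ :=
  Finsupp.equivFunOnFinite.symm fun v => if v ∈ e.1 then (C.weight e : ℕ) else 0

open Classical in
theorem edgeExponent_apply (e : C.graph.edgeSet) (v : V) :
    C.edgeExponent e v = if v ∈ e.1 then (C.weight e : ℕ) else 0 :=
  rfl

theorem monomial_edgeExponent (K : Type*) [Field K] {i j : V} (h : s(i, j) ∈ C.graph.edgeSet) :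
    monomial (C.edgeExponent ⟨s(i, j), h⟩) (1 : K) =
      X i ^ (C.weight ⟨s(i, j), h⟩ : ℕ) * X j ^ (C.weight ⟨s(i, j), h⟩ : ℕ) := by
  classical
  rw [X_pow_eq_monomial, X_pow_eq_monomial, monomial_mul, one_mul]
  congr 2
  ext v
  have := C.graph.ne_of_adj h
  simp only [edgeExponent_apply, Sym2.mem_iff, Finsupp.add_apply, Finsupp.single_apply]
  grind

theorem edgeIdeal_eq_span (K : Type*) [Field K] :
    C.edgeIdeal K = Ideal.span (Set.range fun e => monomial (C.edgeExponent e) (1 : K)) := by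
  unfold edgeIdeal
  congr 1
  ext m
  constructor
  · rintro ⟨i, j, h, rfl⟩
    exact ⟨⟨s(i, j), h⟩, C.monomial_edgeExponent K h⟩
  · rintro ⟨⟨e, he⟩, rfl⟩
    induction e with
    | _ i j => exact ⟨i, j, he, C.monomial_edgeExponent K he⟩

open Classical in
/-- If no edge of weight one joins two distinct edges `e`, `f` with `2 ≤ ω(e) ≤ ω(f)`, then the
monomial `x_e * x_f ^ (ω(f) - 1)` is integral over the edge ideal but does not belong to it. -/
theorem exists_trivial_edge_of_le {K : Type*} [Field K]
    (hI : (C.edgeIdeal K).IsIntegrallyClosedIdeal) {e f : C.graph.edgeSet} (hef : e ≠ f)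
    (he : 2 ≤ (C.weight e : ℕ)) (hle : (C.weight e : ℕ) ≤ C.weight f) :
    ∃ g : C.graph.edgeSet, (C.weight g : ℕ) = 1 ∧ ∃ u ∈ e.1, ∃ v ∈ f.1, g.1 = s(u, v) := by
  by_contra hno
  push Not at hno
  set b : ℕ := (C.weight f : ℕ) with hb
  let ind : C.graph.edgeSet → V →₀ ℕ := fun e =>
    Finsupp.equivFunOnFinite.symm fun v => if v ∈ e.1 then 1 else 0
  have hind : ∀ e v, ind e v = if v ∈ e.1 then 1 else 0 := fun _ _ => rfl
  have hexp : ∀ e, C.edgeExponent e = (C.weight e : ℕ) • ind e := by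
    intro e
    ext v
    simp [edgeExponent_apply, hind]
  have hgen : ∀ e, monomial (C.edgeExponent e) (1 : K) ∈ C.edgeIdeal K := by
    intro e
    rw [edgeIdeal_eq_span]
    exact Ideal.subset_span ⟨e, rfl⟩
  obtain ⟨c, hc⟩ : ∃ c, b = c + 1 := ⟨b - 1, by omega⟩
  have hint : monomial (ind e + c • ind f) (1 : K) ∈ C.edgeIdeal K := by
    have : monomial (ind e + c • ind f) (1 : K) ∈ (C.edgeIdeal K).integralClosureSet := by
      refine Ideal.isIntegralElem_of_pow_mem (k := b) (by omega) ?_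
      -- The `b`-th power contains `b - 1` copies of the generator of `f` and, since `ω(e) ≤ b`, one
      -- of that of `e`.
      have h1 : monomial (ind e + c • ind f) (1 : K) ^ b =
          monomial ((b - C.weight e) • ind e) 1 *
            (monomial (C.edgeExponent f) 1 ^ c * monomial (C.edgeExponent e) 1) := by
        simp only [monomial_pow, monomial_mul, one_pow, one_mul]
        congr 2
        obtain ⟨r, hr⟩ := Nat.exists_eq_add_of_le hle
        rw [hexp, hexp, ← hb, hr, Nat.add_sub_cancel_left]
        module
      rw [h1]
      refine Ideal.mul_mem_left _ _ ?_
      rw [hc, pow_succ]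
      exact Ideal.mul_mem_mul (Ideal.pow_mem_pow (hgen f) c) (hgen e)
    rwa [← hI] at this
  rw [edgeIdeal_eq_span, ← Set.image_univ, ← Set.image_image (fun d => monomial d (1 : K)),
    mem_ideal_span_monomial_image] at hint
  obtain ⟨_, ⟨g, -, rfl⟩, hg⟩ := hint (ind e + c • ind f) (by simp)
  obtain ⟨g, hgE⟩ := g
  induction g with
  | _ u v =>
    have huv : u ≠ v := C.graph.ne_of_adj hgE
    have hu := hg u
    have hv := hg v
    simp only [edgeExponent_apply, Sym2.mem_iff, true_or, or_true, if_true, Finsupp.add_apply,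
      Finsupp.smul_apply, hind, smul_eq_mul, mul_ite, mul_one, mul_zero] at hu hv
    have hpos := (C.weight ⟨s(u, v), hgE⟩).pos
    have both : ∀ e : C.graph.edgeSet, u ∈ e.1 → v ∈ e.1 → (⟨s(u, v), hgE⟩ : C.graph.edgeSet) = e :=
      fun e h1 h2 => Subtype.ext ((Sym2.mem_and_mem_iff huv).mp ⟨h1, h2⟩).symm
    have hg1 := fun h => hno ⟨s(u, v), hgE⟩ h
    -- If `g` is `e` or `f`, its end off the other edge has exponent `1 < ω(e)` or `b - 1 < ω(f)`.
    -- Otherwise `g` must join an end of `e` only, where the exponent 1 forces weight one, to an end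
    -- of `f`.
    by_cases hue : u ∈ e.1 <;> by_cases hve : v ∈ e.1 <;> by_cases huf : u ∈ f.1 <;>
      by_cases hvf : v ∈ f.1 <;> simp only [hue, hve, huf, hvf, if_true, if_false] at hu hv <;>
      first
      | omega
      | exact hef ((both e hue hve).symm.trans (both f huf hvf))
      | (rw [both e hue hve] at hu; omega)
      | (rw [both f huf hvf] at hu hv; omega)
      | exact hg1 (by omega) u hue v hvf rfl
      | exact hg1 (by omega) v hve u huf Sym2.eq_swap

theorem exists_trivial_edge {K : Type*} [Field K]
    (hI : (C.edgeIdeal K).IsIntegrallyClosedIdeal) {e f : C.graph.edgeSet} (hef : e ≠ f)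
    (he : 2 ≤ (C.weight e : ℕ)) (hf : 2 ≤ (C.weight f : ℕ)) :
    ∃ g : C.graph.edgeSet, (C.weight g : ℕ) = 1 ∧ ∃ u ∈ e.1, ∃ v ∈ f.1, g.1 = s(u, v) := by
  rcases le_total (C.weight e : ℕ) (C.weight f) with h | h
  · exact C.exists_trivial_edge_of_le hI hef he h
  · obtain ⟨g, hg, u, hu, v, hv, huv⟩ := C.exists_trivial_edge_of_le hI hef.symm hf h
    exact ⟨g, hg, v, hv, u, hu, huv.trans Sym2.eq_swap⟩

end EdgeExponent

/-! ### Exchange and rounding of fractional packings -/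

section Exchange

variable [Fintype V] (C : EdgeWeightedGraph V) [Fintype C.graph.edgeSet]

/-- `y` is a fractional packing of total size `k` of the generators of the edge ideal into the
exponent vector `d`. -/
structure IsFractionalPacking (k : ℕ) (d : V → ℕ) (y : C.graph.edgeSet → ℝ) : Prop where
  nonneg : ∀ e, 0 ≤ y e
  sum_eq : ∑ e, y e = k
  sum_le : ∀ v, ∑ e, y e * C.edgeExponent e v ≤ d v

open Classical in
/-- Weight can be moved from two nontrivial edges to a trivial edge that joins them until at most
one nontrivial edge is used. -/
theorem IsFractionalPacking.exists_trivial_off [Nonempty C.graph.edgeSet]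
    (hC : ∀ e f : C.graph.edgeSet, e ≠ f → 2 ≤ (C.weight e : ℕ) → 2 ≤ (C.weight f : ℕ) →
      ∃ g : C.graph.edgeSet, (C.weight g : ℕ) = 1 ∧ ∃ u ∈ e.1, ∃ v ∈ f.1, g.1 = s(u, v))
    {k : ℕ} {d : V → ℕ} {y : C.graph.edgeSet → ℝ} (hy : C.IsFractionalPacking k d y) :
    ∃ y', C.IsFractionalPacking k d y' ∧
      ∃ e₀, ∀ e, e ≠ e₀ → y' e ≠ 0 → (C.weight e : ℕ) = 1 := by
  induction hN : (Finset.univ.filter fun e => y e ≠ 0 ∧ 2 ≤ (C.weight e : ℕ)).card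
    using Nat.strong_induction_on generalizing y with
  | _ N ih =>
    by_cases hone : ∃ e₀, ∀ e, e ≠ e₀ → y e ≠ 0 → (C.weight e : ℕ) = 1
    · exact ⟨y, hy, hone⟩
    have hnt : ∀ e₀, ∃ e, e ≠ e₀ ∧ y e ≠ 0 ∧ 2 ≤ (C.weight e : ℕ) := by
      intro e₀
      push Not at hone
      obtain ⟨e, h1, h2, h3⟩ := hone e₀
      have := (C.weight e).pos
      exact ⟨e, h1, h2, by omega⟩
    obtain ⟨e, -, hye, hwe⟩ := hnt (Classical.arbitrary _)
    obtain ⟨f, hfe, hyf, hwf⟩ := hnt e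
    obtain ⟨g, hwg, u, hu, v, hv, hguv⟩ := hC e f hfe.symm hwe hwf
    have hge : g ≠ e := by rintro rfl; omega
    have hgf : g ≠ f := by rintro rfl; omega
    -- The minimum makes `e` or `f` drop out of the support; adding `2 * t` at `g` preserves the
    -- total.
    set t := min (y e) (y f) with ht
    have ht0 : 0 ≤ t := le_min (hy.nonneg e) (hy.nonneg f)
    let y' : C.graph.edgeSet → ℝ := fun i =>
      y i - (if i = e then t else 0) - (if i = f then t else 0) + (if i = g then 2 * t else 0)
    have hsum : ∀ F : C.graph.edgeSet → ℝ,
        ∑ i, y' i * F i = ∑ i, y i * F i - t * F e - t * F f + 2 * t * F g := by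
      intro F
      simp [y', add_mul, sub_mul, Finset.sum_add_distrib, Finset.sum_sub_distrib, ite_mul]
    have hye' : y' e = y e - t := by simp [y', hfe.symm, hge.symm]
    have hyf' : y' f = y f - t := by simp [y', hfe, hgf.symm]
    have hyo : ∀ i, i ≠ e → i ≠ f → i ≠ g → y' i = y i := by
      intro i h1 h2 h3
      simp [y', h1, h2, h3]
    have hy' : C.IsFractionalPacking k d y' := by
      refine ⟨fun i => ?_, ?_, fun x => ?_⟩
      · by_cases h1 : i = e
        · rw [h1, hye']
          exact sub_nonneg.mpr (min_le_left _ _)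
        by_cases h2 : i = f
        · rw [h2, hyf']
          exact sub_nonneg.mpr (min_le_right _ _)
        have := hy.nonneg i
        simp only [y', h1, h2, if_false]
        split_ifs <;> linarith
      · have := hsum fun _ => 1
        simp only [mul_one] at this
        rw [this, hy.sum_eq]
        ring
      · refine le_trans ?_ (hy.sum_le x)
        rw [hsum]
        -- Each end of `g` lies on `e` or `f`, whose weight is at least 2.
        have hkey : 2 * C.edgeExponent g x ≤ C.edgeExponent e x + C.edgeExponent f x := by
          simp only [edgeExponent_apply, hwg, hguv, Sym2.mem_iff]
          by_cases hxu : x = u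
          · subst hxu
            simp only [hu, true_or, if_true]
            omega
          by_cases hxv : x = v
          · subst hxv
            simp only [hv, or_true, if_true]
            omega
          simp [hxu, hxv]
        have hkey' : (2 : ℝ) * C.edgeExponent g x ≤ C.edgeExponent e x + C.edgeExponent f x := by
          exact_mod_cast hkey
        nlinarith
    refine ih _ ?_ hy' rfl
    rw [← hN]
    refine Finset.card_lt_card (Finset.ssubset_iff_of_subset ?_ |>.mpr ?_)
    · intro i hi
      simp only [Finset.mem_filter, Finset.mem_univ, true_and] at hi ⊢
      refine ⟨?_, hi.2⟩
      by_cases h1 : i = e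
      · rwa [h1]
      by_cases h2 : i = f
      · rwa [h2]
      have h3 : i ≠ g := by
        rintro rfl
        omega
      rw [← hyo i h1 h2 h3]
      exact hi.1
    · rcases min_choice (y e) (y f) with h | h
      · exact ⟨e, by simp [hye, hwe], by simp [hye', ht, h]⟩
      · exact ⟨f, by simp [hyf, hwf], by simp [hyf', ht, h]⟩

open Classical in
theorem IsFractionalPacking.exists_nat (hC : C.IsCycle) {k : ℕ} {d : V → ℕ}
    {y : C.graph.edgeSet → ℝ} (hy : C.IsFractionalPacking k d y) {e₀ : C.graph.edgeSet}
    (he₀ : ∀ e, e ≠ e₀ → y e ≠ 0 → (C.weight e : ℕ) = 1) :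
    ∃ z : C.graph.edgeSet → ℕ, k ≤ ∑ e, z e ∧ ∀ v, ∑ e, z e * C.edgeExponent e v ≤ d v := by
  obtain ⟨L, hLn, hLG, -, hLall, hLint⟩ := hC.1.exists_list_edges hC.2 e₀.2
  let y₁ : C.graph.edgeSet → ℝ := fun e => if e = e₀ then 0 else y e
  have hsplit : ∀ F : C.graph.edgeSet → ℝ,
      ∑ e, y e * F e = ∑ e, y₁ e * F e + y e₀ * F e₀ := by
    intro F
    rw [← Finset.sum_erase_add _ _ (Finset.mem_univ e₀),
      ← Finset.sum_erase_add _ (fun e => y₁ e * F e) (Finset.mem_univ e₀)]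
    have : y₁ e₀ = 0 := by simp [y₁]
    rw [this, zero_mul, add_zero]
    congr 1
    refine Finset.sum_congr rfl fun e he => ?_
    simp [y₁, Finset.ne_of_mem_erase he]
  obtain ⟨z, hz0, hzsum, hz⟩ := exists_rounding_of_list (ι := C.graph.edgeSet) (L := L.attachWith _ hLG)
    (List.Nodup.of_map Subtype.val (by simpa using hLn)) y₁
    (fun e => by dsimp only [y₁]; split_ifs; exacts [le_rfl, hy.nonneg e])
    (fun e he => by
      by_cases h : e = e₀
      · simp [y₁, h]
      · exact absurd (hLall e.1 e.2 fun h' => h (Subtype.ext h')) (by simpa using he))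
  -- Every edge used by `y₁` has weight one, so its exponent vector is 0/1.
  have hy₁ : ∀ e v, y₁ e * C.edgeExponent e v = if v ∈ e.1 then y₁ e else 0 := by
    intro e v
    by_cases h : y₁ e = 0
    · simp [h]
    · have hne : e ≠ e₀ := by rintro rfl; simp [y₁] at h
      have := he₀ e hne (by simpa [y₁, hne] using h)
      simp [edgeExponent_apply, this]
  have hz₁ : ∀ e v, z e * C.edgeExponent e v = if v ∈ e.1 then z e else 0 := by
    intro e v
    by_cases h : z e = 0
    · simp [h]
    · have hy0 : y₁ e ≠ 0 := fun h' => h (hz0 e h')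
      have hne : e ≠ e₀ := by rintro rfl; simp [y₁] at hy0
      have := he₀ e hne (by simpa [y₁, hne] using hy0)
      simp [edgeExponent_apply, this]
  set q := ⌊y e₀⌋₊
  have hq : (q : ℝ) ≤ y e₀ := Nat.floor_le (hy.nonneg e₀)
  refine ⟨fun e => z e + if e = e₀ then q else 0, ?_, fun v => ?_⟩
  · have h1 := hsplit fun _ => 1
    simp only [mul_one] at h1
    rw [hy.sum_eq] at h1
    have h2 : y e₀ < q + 1 := Nat.lt_floor_add_one _
    -- Only the floor at `e₀` loses mass, and less than one unit; integrality of the totals then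
    -- gives `k`.
    have h3 : (k : ℝ) < (∑ e, z e : ℕ) + q + 1 := by
      push_cast
      linarith
    have h4 : k < ∑ e, z e + q + 1 := by exact_mod_cast h3
    rw [Finset.sum_add_distrib]
    simp only [Finset.sum_ite_eq', Finset.mem_univ, if_true]
    omega
  · have h1 := hsplit fun e => C.edgeExponent e v
    have h2 := hy.sum_le v
    have h3 : 0 ≤ ∑ e, y₁ e * (C.edgeExponent e v : ℝ) := by
      refine Finset.sum_nonneg fun e _ => mul_nonneg ?_ (Nat.cast_nonneg _)
      dsimp only [y₁]
      split_ifs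
      exacts [le_rfl, hy.nonneg e]
    have h4 : (q : ℝ) * C.edgeExponent e₀ v ≤ y e₀ * C.edgeExponent e₀ v := by gcongr
    have h5 : q * C.edgeExponent e₀ v ≤ d v := by
      have : (q : ℝ) * C.edgeExponent e₀ v ≤ d v := by linarith
      exact_mod_cast this
    -- Rounding down at `e₀` makes the capacity left for the path an integer, as the interval
    -- rounding requires.
    have h6 : ∑ e, (if v ∈ e.1 then z e else 0) ≤ d v - q * C.edgeExponent e₀ v := by
      refine hz (fun e => v ∈ e.1) ?_ _ ?_
      · obtain ⟨s, t, hst⟩ := hLint v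
        exact ⟨s, t, fun j hj => by simpa using hst j (by simpa using hj)⟩
      · simp only [← hy₁]
        rw [Nat.cast_sub h5]
        push_cast
        linarith
    simp only [← hz₁] at h6
    simp only [add_mul, Finset.sum_add_distrib, ite_mul, zero_mul, Finset.sum_ite_eq',
      Finset.mem_univ, if_true]
    omega

end Exchange

/-- The edge ideal of a weighted cycle is normal if it is integrally closed. -/
theorem IsCycle.isNormalIdeal_edgeIdeal [Finite V] {C : EdgeWeightedGraph V} (hC : C.IsCycle)
    {K : Type*} [Field K] (hI : (C.edgeIdeal K).IsIntegrallyClosedIdeal) :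
    (C.edgeIdeal K).IsNormalIdeal := by
  classical
  have := Fintype.ofFinite V
  have := Fintype.ofFinite C.graph.edgeSet
  have hne : Nonempty C.graph.edgeSet := by
    obtain ⟨v⟩ := hC.1.nonempty
    obtain ⟨w, hw⟩ := Set.nonempty_of_ncard_ne_zero (s := C.graph.neighborSet v) (by simp [hC.2 v])
    exact ⟨s(v, w), hw⟩
  intro k hk
  refine Set.Subset.antisymm (fun f hf => ?_) fun f hf => ?_
  · exact Ideal.isIntegralElem_of_pow_mem le_rfl (by simpa using hf)
  · rw [edgeIdeal_eq_span] at hf ⊢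
    rw [SetLike.mem_coe, ← f.support_sum_monomial_coeff]
    refine sum_mem fun d hd => ?_
    obtain ⟨y, hy0, hy1, hy2⟩ := exists_fractional_of_isIntegralElem_pow _ k hf hd
    obtain ⟨y', hy', e₀, he₀⟩ := IsFractionalPacking.exists_trivial_off C
      (fun e f => C.exists_trivial_edge hI) (IsFractionalPacking.mk hy0 hy1 hy2)
    obtain ⟨z, hz, hzd⟩ := hy'.exists_nat C hC he₀
    exact monomial_mem_span_pow _ z hz hzd _

end EdgeWeightedGraph

theorem theorem4p9 {K : Type*} [Field K] {n : ℕ} (C : EdgeWeightedGraph (Fin n))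
    (hC : C.IsCycle) (hI : (C.edgeIdeal K).IsIntegrallyClosedIdeal) :
    (C.edgeIdeal K).IsNormalIdeal :=
  hC.isNormalIdeal_edgeIdeal hI
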